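/- Let $\mathbb F$ be a finite field and $0<k<n$. A submodule $\mathcal C\subseteq\mathbb F[z]^n$ is an $(n,k,\delta)$ convolutional code over $\mathbb F$ if $\mathcal C=\{u(z)G(z) : u(z)\in\mathbb F[z]^k\}$ for some matrix $G(z)\in\mathbb F[z]^{k\times n}$ of full row rank, where $\delta$ is the highest degree of the $k\times k$ minors of $G(z)$ (this does not depend on the choice of $G$). For $v(z)=\sum_i v_iz^i\in\mathbb F[z]^n$ with $v_i\in\mathbb F^n$, let $\mathrm{wt}_{\mathrm H}(v_i)$ be the number of nonzero entries of $v_i$, and define the $j$-th column distance of $\mathcal C$ by $$\mathrm d_j^{\mathrm c}(\mathcal C)=\min\Big\{\sum_{i=0}^{j}\mathrm{wt}_{\mathrm H}(v_i) : v(z)\in\mathcal C,\ v_0\neq 0\Big\}.$$ An $(n,k,\delta)$ convolutional code $\mathcal C$ is maximum distance profile (MDP) if $\mathrm d_j^{\mathrm c}(\mathcal C)=(n-k)(j+1)+1$ for all $0\le j\le \lfloor \delta/k\rfloor+\lfloor\delta/(n-k)\rfloor$. Let $k,n,\delta$ be positive integers with $k<n$, put $t=\min\{k,n-k\}$, let $q>n$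 be a prime power and let $s$ be a positive integer. (1) If $$s>\frac{\delta^3}{3t}+\frac{3\delta^2}{4}+\frac{\delta t}{12},$$ then there exists an $(n,k,\delta)$ MDP convolutional code over $\mathbb F_{q^s}$. (2) There also exists an $(n,k,\delta)$ MDP convolutional code over $\mathbb F_{q^s}$ whenever $$s>\frac{11}{24}\left(\frac{\delta^3}{t}+\delta t\right).$$ -/

import Mathlib

open Polynomial Matrix

namespace ConvCode

variable {F : Type*} [Field F] {n k : ℕ}

/-- `G(z)` is a generator matrix of the submodule `C` of `F[z]^n`: it has full row rank, and
`C = {u(z) G(z) | u(z) ∈ F[z]^k}`. -/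
def IsGeneratorMatrix (C : Submodule F[X] (Fin n → F[X])) (G : Matrix (Fin k) (Fin n) F[X]) :
    Prop :=
  LinearIndependent F[X] G.row ∧ (C : Set (Fin n → F[X])) = Set.range fun u => u ᵥ* G

/-- The highest degree of the `k × k` minors of a `k × n` polynomial matrix; a minor is given by
an increasing choice of `k` columns. -/
noncomputable def maxMinorDegree (G : Matrix (Fin k) (Fin n) F[X]) : ℕ :=
  Finset.univ.sup fun e : Fin k ↪o Fin n => (G.submatrix id e).det.natDegree

/-- `C` is an `(n, k, δ)` convolutional code over `F`. The degree does not depend on the choice of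
the generator matrix, since two of them differ by a unimodular factor. -/
def IsConvolutionalCode (n k δ : ℕ) (C : Submodule F[X] (Fin n → F[X])) : Prop :=
  ∃ G : Matrix (Fin k) (Fin n) F[X], IsGeneratorMatrix C G ∧ maxMinorDegree G = δ

/-- The coefficient vector `v_i ∈ F^n` of `z^i` in `v(z) ∈ F[z]^n`. -/
def coeffVec (v : Fin n → F[X]) (i : ℕ) : Fin n → F := fun l => (v l).coeff i

open Classical in
/-- The weight of `v_{[0,j]}(z) = ∑_{i ≤ j} v_i z^i`: the sum of the Hamming weights of
`v_0, …, v_j`. -/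
noncomputable def truncWeight (v : Fin n → F[X]) (j : ℕ) : ℕ :=
  ∑ i ∈ Finset.range (j + 1), hammingNorm (coeffVec v i)

/-- The `j`-th column distance of `C`, the minimum of the weights of the truncations
`v_{[0,j]}(z)` of the codewords `v(z)` with `v_0 ≠ 0`. -/
noncomputable def columnDistance (C : Submodule F[X] (Fin n → F[X])) (j : ℕ) : ℕ :=
  sInf {w : ℕ | ∃ v ∈ C, coeffVec v 0 ≠ 0 ∧ truncWeight v j = w}

/-- `C` is an `(n, k, δ)` convolutional code that is maximum distance profile: its column
distances attain the bound `(n - k) (j + 1) + 1` for all `0 ≤ j ≤ L`, where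
`L = ⌊δ / k⌋ + ⌊δ / (n - k)⌋`. It is used for `0 < k < n`. -/
def IsMDPCode (n k δ : ℕ) (C : Submodule F[X] (Fin n → F[X])) : Prop :=
  IsConvolutionalCode n k δ C ∧
    ∀ j ≤ δ / k + δ / (n - k), columnDistance C j = (n - k) * (j + 1) + 1

end ConvCode

/-! The code is generated by a weighted Reed-Solomon matrix: the coefficient of `z^i` in entry `(r,
c)` is `x_c^(r - k i) γ^(w(r, i))`, with distinct nonzero `x_c` in a field `K` of order `q`, with
`γ` of degree `s` over `K`, and with `w` the function `rowWeight k`. A codeword whose truncation is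
too light has so many zeros that a nonzero minor of the sliding generator matrix forces `v_0 = 0`;
so the MDP property reduces to `NontrivialMinorsNeZero`.

A nonzero sliding entry in row `ρ` and block column `b` is `x^(ρ - k b)` times a power of `γ`. The
quadratic `w` is chosen so that this power is `-b ρ` up to a row term and a column term. By the
rearrangement inequality, the lowest power of `γ` in a minor comes exactly from the block-preserving
permutations, and its coefficient is a determinant built from generalized Vandermonde blocks
(`det_initialMatrix_ne_zero`). The minor is thus a nonzero polynomial over `K` evaluated at `γ`, and
it can vanish only if its exponents spread over at least `s` (`aeval_ne_zero_of_natDegree_lt`).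

The spread is at most `L S / 4`, where `L = ⌊δ/k⌋ + ⌊δ/(n-k)⌋` and `S` is the sum of `rowSpread`
(`permWeight_sub_le`). Centering the weights by a linear term, which cancels between permutations,
makes their increments run through `2e + 1 - δ` for `e < δ`; hence `S ≤ δ²` and `S ≤ δ²/2 + δ(k-1)`.
Both numerical conditions on `s` follow from these two bounds and `L ≤ δ/k + δ/t`. -/

namespace ConvCode

/-! ### Row weights and their oscillation -/

/-- The exponent of the weight in row `r` and degree `i` of a weighted Reed-Solomon generator
matrix with `k` rows. -/
def rowWeight (k r i : ℕ) : ℕ := ∑ j ∈ Finset.range i, ((j + 1) * k - r)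

lemma two_mul_rowWeight {k r : ℕ} (hr : r < k) (i : ℕ) :
    (2 * rowWeight k r i : ℤ) = k * i * (i + 1) - 2 * r * i := by
  induction i with
  | zero => simp [rowWeight]
  | succ i ih =>
    have h : r ≤ (i + 1) * k := hr.le.trans (Nat.le_mul_of_pos_left _ (Nat.succ_pos i))
    rw [rowWeight, Finset.sum_range_succ, ← rowWeight, Nat.cast_add, mul_add, ih, Nat.cast_sub h]
    push_cast
    ring

/-- Up to a term depending only on the row and one depending only on the column, the weight at row
`ρ` and block `b` of the sliding matrix is `-b ρ`. -/
lemma two_mul_rowWeight_sliding {k : ℕ} (hk : 0 < k) {ρ b : ℕ} (h : ρ / k ≤ b) :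
    (2 * rowWeight k (ρ % k) (b - ρ / k) : ℤ) =
      (k * b * (b + 1)) + (k * (ρ / k : ℕ) * ((ρ / k : ℕ) - 1) + 2 * (ρ % k : ℕ) * (ρ / k : ℕ))
        - 2 * (b * ρ) := by
  rw [two_mul_rowWeight (Nat.mod_lt _ hk), Nat.cast_sub h]
  have hρ : (ρ : ℤ) = k * (ρ / k : ℕ) + (ρ % k : ℕ) := by
    exact_mod_cast (Nat.div_add_mod ρ k).symm
  generalize ((ρ / k : ℕ) : ℤ) = a at *
  generalize ((ρ % k : ℕ) : ℤ) = r at *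
  rw [hρ]
  ring

/-- Splitting `0, …, δ - 1` into residue classes modulo `k`. -/
lemma sum_range_residues {M : Type*} [AddCommMonoid M] {k : ℕ} (hk : 0 < k) (δ : ℕ) (f : ℕ → M) :
    ∑ r ∈ Finset.range k, ∑ j ∈ Finset.range ((δ + r) / k), f ((j + 1) * k - 1 - r) =
      ∑ e ∈ Finset.range δ, f e := by
  rw [Finset.sum_sigma']
  refine Finset.sum_nbij' (fun x => (x.2 + 1) * k - 1 - x.1)
    (fun e => ⟨k - 1 - e % k, e / k⟩) ?_ ?_ ?_ ?_ (fun _ _ => rfl)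
  · rintro ⟨r, j⟩ h
    simp only [Finset.mem_sigma, Finset.mem_range] at h ⊢
    have h2 : (j + 1) * k ≤ δ + r := (Nat.le_div_iff_mul_le hk).1 h.2
    have h3 : k ≤ (j + 1) * k := Nat.le_mul_of_pos_left _ (Nat.succ_pos j)
    omega
  · intro e h
    simp only [Finset.mem_sigma, Finset.mem_range] at h ⊢
    have h1 := Nat.div_add_mod e k
    have h2 := Nat.mod_lt e hk
    refine ⟨by omega, (Nat.le_div_iff_mul_le hk).2 ?_⟩
    have : (e / k).succ * k = k * (e / k) + k := by rw [Nat.succ_eq_add_one]; ring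
    omega
  · rintro ⟨r, j⟩ h
    simp only [Finset.mem_sigma, Finset.mem_range] at h ⊢
    have h3 : (j + 1) * k - 1 - r = (k - 1 - r) + k * j := by
      have : (j + 1) * k = k * j + k := by ring
      omega
    have h4 : k - 1 - r < k := by omega
    rw [h3, Nat.add_mul_mod_self_left, Nat.mod_eq_of_lt h4, Nat.add_mul_div_left _ _ hk,
      Nat.div_eq_of_lt h4]
    congr 1
    · omega
    · omega
  · intro e h
    have h1 := Nat.div_add_mod e k
    have h2 := Nat.mod_lt e hk
    have : (e / k + 1) * k = k * (e / k) + k := by ring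
    simp only
    omega

lemma sum_div_residues {k : ℕ} (hk : 0 < k) (δ : ℕ) :
    ∑ r ∈ Finset.range k, (δ + r) / k = δ := by
  simpa only [Finset.sum_const, Finset.card_range, smul_eq_mul, mul_one] using
    sum_range_residues (M := ℕ) hk δ (fun _ => 1)

/-- Deleting the two extreme terms of `1-δ, 3-δ, …, δ-1` leaves the list for `δ-2`, hence the
induction by two steps; the two new terms contribute exactly `(δ+2)² - δ²`. -/
lemma sum_abs_centered (δ : ℕ) :
    2 * ∑ e ∈ Finset.range δ, |(2 * e + 1 - δ : ℤ)| ≤ (δ : ℤ) ^ 2 := by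
  induction δ using Nat.twoStepInduction with
  | zero => simp
  | one => simp
  | more δ ih _ =>
    rw [Finset.sum_range_succ, Finset.sum_range_succ']
    have h : ∀ e : ℕ, |(2 * ((e + 1 : ℕ) : ℤ) + 1 - ((δ + 2 : ℕ) : ℤ))| = |(2 * e + 1 - δ : ℤ)| := by
      intro e
      push_cast
      congr 1
      ring
    simp only [h]
    have h1 : |(2 * ((0 : ℕ) : ℤ) + 1 - ((δ + 2 : ℕ) : ℤ))| = δ + 1 := by
      rw [abs_of_nonpos (by push_cast; omega)]
      push_cast
      ring
    have h2 : |(2 * (δ : ℤ) + 1 - δ)| = δ + 1 := by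
      rw [abs_of_nonneg (by omega)]
      ring
    rw [h1, h2]
    push_cast
    nlinarith

/-- The oscillation of the partial sums of `x 0, …, x (M - 1)`. -/
lemma two_mul_partialSum_sub_le (x : ℕ → ℤ) {M i i' : ℕ} (hi : i ≤ M) (hi' : i' ≤ M) :
    2 * (∑ j ∈ Finset.range i, x j - ∑ j ∈ Finset.range i', x j) ≤
      ∑ j ∈ Finset.range M, |x j| + |∑ j ∈ Finset.range M, x j| := by
  rcases le_total i' i with h | h
  · rw [← Finset.sum_Ico_eq_sub _ h]
    -- An interval sum is at most the sum of all positive parts, and `2 x⁺ = |x| + x`. The other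
    -- case uses negative parts.
    have h1 : ∑ j ∈ Finset.Ico i' i, 2 * x j ≤ ∑ j ∈ Finset.range M, (|x j| + x j) := by
      refine (Finset.sum_le_sum fun j _ => ?_).trans (Finset.sum_le_sum_of_subset_of_nonneg
        (fun j hj => ?_) fun j _ _ => ?_)
      · linarith [le_abs_self (x j)]
      · simp only [Finset.mem_Ico, Finset.mem_range] at hj ⊢; omega
      · linarith [neg_abs_le (x j)]
    rw [← Finset.mul_sum, Finset.sum_add_distrib] at h1
    linarith [le_abs_self (∑ j ∈ Finset.range M, x j)]
  · rw [← neg_sub, ← Finset.sum_Ico_eq_sub _ h]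
    have h1 : ∑ j ∈ Finset.Ico i i', (-2) * x j ≤ ∑ j ∈ Finset.range M, (|x j| - x j) := by
      refine (Finset.sum_le_sum fun j _ => ?_).trans (Finset.sum_le_sum_of_subset_of_nonneg
        (fun j hj => ?_) fun j _ _ => ?_)
      · linarith [neg_abs_le (x j)]
      · simp only [Finset.mem_Ico, Finset.mem_range] at hj ⊢; omega
      · linarith [le_abs_self (x j)]
    rw [← Finset.mul_sum, Finset.sum_sub_distrib] at h1
    linarith [neg_abs_le (∑ j ∈ Finset.range M, x j)]

/-- The increments of twice the centered weights of row `r`. -/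
def centeredStep (k δ r j : ℕ) : ℤ := 2 * ((j + 1) * k - 1 - r : ℤ) + 1 - δ

lemma centeredStep_eq {k r : ℕ} (hr : r < k) (δ j : ℕ) :
    centeredStep k δ r j = 2 * (((j + 1) * k - 1 - r : ℕ) : ℤ) + 1 - δ := by
  have h3 : k ≤ (j + 1) * k := Nat.le_mul_of_pos_left _ (Nat.succ_pos j)
  rw [centeredStep, Nat.cast_sub (by omega), Nat.cast_sub (by omega)]
  push_cast
  ring

/-- The correction is linear in `i`, so over a whole permutation it adds up to a constant. -/
lemma sum_centeredStep {k r : ℕ} (hr : r < k) (δ i : ℕ) :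
    ∑ j ∈ Finset.range i, centeredStep k δ r j = 2 * rowWeight k r i - (δ + 1) * i := by
  rw [two_mul_rowWeight hr]
  induction i with
  | zero => simp
  | succ i ih =>
    rw [Finset.sum_range_succ, ih, centeredStep]
    push_cast
    ring

/-- Twice the oscillation of twice the centered weights of row `r` is at most this number. -/
def rowSpread (k δ r : ℕ) : ℤ :=
  ∑ j ∈ Finset.range ((δ + r) / k), |centeredStep k δ r j| +
    |∑ j ∈ Finset.range ((δ + r) / k), centeredStep k δ r j|

lemma rowSpread_nonneg (k δ r : ℕ) : 0 ≤ rowSpread k δ r :=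
  add_nonneg (Finset.sum_nonneg fun _ _ => abs_nonneg _) (abs_nonneg _)

lemma sum_abs_centeredStep {k : ℕ} (hk : 0 < k) (δ : ℕ) :
    2 * ∑ r ∈ Finset.range k, ∑ j ∈ Finset.range ((δ + r) / k), |centeredStep k δ r j| ≤
      (δ : ℤ) ^ 2 := by
  refine le_trans (le_of_eq ?_) (sum_abs_centered δ)
  rw [← sum_range_residues hk δ]
  congr 1
  refine Finset.sum_congr rfl fun r hr => Finset.sum_congr rfl fun j _ => ?_
  rw [centeredStep_eq (Finset.mem_range.1 hr)]

lemma sum_rowSpread_le_sq {k : ℕ} (hk : 0 < k) (δ : ℕ) :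
    ∑ r ∈ Finset.range k, rowSpread k δ r ≤ (δ : ℤ) ^ 2 := by
  refine le_trans ?_ (sum_abs_centeredStep hk δ)
  rw [Finset.mul_sum]
  refine Finset.sum_le_sum fun r _ => ?_
  rw [rowSpread, two_mul]
  gcongr
  exact Finset.abs_sum_le_sum_abs _ _

/-- With `δ + r = k m + d`, the increments of row `r` add up to `m (k - 1 - r - d)`, of absolute
value at most `m (k - 1)`; the numbers `m` sum to `δ`. -/
lemma two_mul_sum_rowSpread_le {k : ℕ} (hk : 0 < k) (δ : ℕ) :
    2 * ∑ r ∈ Finset.range k, rowSpread k δ r ≤ (δ : ℤ) ^ 2 + 2 * (δ * (k - 1)) := by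
  have h1 : ∑ r ∈ Finset.range k, |∑ j ∈ Finset.range ((δ + r) / k), centeredStep k δ r j| ≤
      ∑ r ∈ Finset.range k, (((δ + r) / k : ℕ) : ℤ) * (k - 1) := by
    refine Finset.sum_le_sum fun r hr => ?_
    have hr := Finset.mem_range.1 hr
    rw [sum_centeredStep hr, two_mul_rowWeight hr]
    have h2 := Nat.div_add_mod (δ + r) k
    have h3 := Nat.mod_lt (δ + r) hk
    set m := (δ + r) / k
    set d := (δ + r) % k
    have h4 : (δ : ℤ) = k * m + d - r := by
      have : ((k * m + d : ℕ) : ℤ) = δ + r := by exact_mod_cast h2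
      push_cast at this
      linarith
    rw [h4, show (k : ℤ) * m * (m + 1) - 2 * r * m - (k * m + d - r + 1) * m =
      m * (k - r - d - 1) by ring, abs_mul, Nat.abs_cast]
    refine mul_le_mul_of_nonneg_left ?_ (by positivity)
    rw [abs_le]
    constructor <;> omega
  rw [← Finset.sum_mul] at h1
  have h5 : (∑ r ∈ Finset.range k, (((δ + r) / k : ℕ) : ℤ)) = δ := by
    exact_mod_cast sum_div_residues hk δ
  rw [h5] at h1
  have h6 := sum_abs_centeredStep hk δ
  simp only [rowSpread, Finset.sum_add_distrib]
  linarith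

end ConvCode

namespace ConvCode

/-! ### Sliding entries and the coefficient of lowest weight -/

section Minor

variable {K : Type*} [Field K]

/-- A generalized Vandermonde system with exponents in a window as long as the number of nodes has
only the trivial solution. -/
lemma eq_zero_of_sum_mul_pow_eq_zero {ι : Type*} [Fintype ι] {y : ι → K}
    (hy : Function.Injective y) (hy0 : ∀ j, y j ≠ 0) {ε : ι → ℕ} (hε : Function.Injective ε) (e : ℕ)
    (h1 : ∀ i, e ≤ ε i) (h2 : ∀ i, ε i < e + Fintype.card ι) {v : ι → K}
    (hv : ∀ j, ∑ i, v i * y j ^ ε i = 0) : v = 0 := by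
  rcases isEmpty_or_nonempty ι with hι | hι
  · exact Subsingleton.elim _ _
  have hp : (∑ i, C (v i) * X ^ (ε i - e) : K[X]) = 0 := by
    refine eq_zero_of_natDegree_lt_card_of_eval_eq_zero _ hy (fun j => ?_) ?_
    · have h3 : y j ^ e * eval (y j) (∑ i, C (v i) * X ^ (ε i - e)) = 0 := by
        rw [← hv j, eval_finsetSum, Finset.mul_sum]
        refine Finset.sum_congr rfl fun i _ => ?_
        rw [eval_C_mul, eval_X_pow, mul_left_comm, ← pow_add, Nat.add_sub_cancel' (h1 i)]
      exact (mul_eq_zero.1 h3).resolve_left (pow_ne_zero _ (hy0 j))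
    · have hc : 0 < Fintype.card ι := Fintype.card_pos
      refine lt_of_le_of_lt (natDegree_sum_le_of_forall_le (n := Fintype.card ι - 1) _ _
        fun i _ => (natDegree_C_mul_X_pow_le _ _).trans ?_) (by omega)
      have := h1 i
      have := h2 i
      omega
  funext i
  have h4 := congrArg (fun p => p.coeff (ε i - e)) hp
  simp only [finsetSum_coeff, coeff_C_mul, coeff_X_pow, coeff_zero] at h4
  rw [Finset.sum_eq_single i] at h4
  · simpa using h4
  · intro i' _ hi'
    have : ε i ≠ ε i' := fun h => hi' (hε h).symm
    have := h1 i
    have := h1 i'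
    rw [if_neg (by omega), mul_zero]
  · simp

/-- The entry of the sliding generator matrix, as a polynomial in the weight `γ`, in row `ρ % k` of
block row `ρ / k` and in the column with evaluation point `x` of block column `b`. -/
noncomputable def slidingEntry (δ k : ℕ) (x : K) (ρ b : ℕ) : K[X] :=
  if ρ / k ≤ b ∧ b * k ≤ δ + ρ then
    C (x ^ (ρ % k) * x⁻¹ ^ (k * (b - ρ / k))) * X ^ rowWeight k (ρ % k) (b - ρ / k) else 0

variable {N : ℕ} {b : Fin N → ℕ} {y : Fin N → K} {k : ℕ}

/-- The coefficients of the terms of minimal weight in a sliding minor. -/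
noncomputable def initialMatrix (k : ℕ) (b : Fin N → ℕ) (y : Fin N → K) :
    Matrix (Fin N) (Fin N) K :=
  of fun ρ j => if b ρ = b j then y j ^ (ρ % k : ℕ) * (y j)⁻¹ ^ (k * (b j - ρ / k)) else 0

/-- The matrix is block diagonal, with entries `y^(ρ - k β)` in block `β`. As `b` is monotone, the
rows of a block form an interval, so the generalized Vandermonde lemma applies to each block. -/
lemma det_initialMatrix_ne_zero (hb : Monotone b) (hy : ∀ i j, b i = b j → y i = y j → i = j)
    (hy0 : ∀ j, y j ≠ 0) (hlow : ∀ ρ : Fin N, (ρ : ℕ) / k ≤ b ρ) :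
    (initialMatrix k b y).det ≠ 0 := by
  intro h
  obtain ⟨v, hv, hv0⟩ := exists_vecMul_eq_zero_iff.2 h
  refine hv (funext fun ρ₀ => ?_)
  let β := b ρ₀
  let ι := {ρ : Fin N // b ρ = β}
  let S : Finset (Fin N) := Finset.univ.filter fun ρ => b ρ = β
  have hS : S.Nonempty := ⟨ρ₀, by simp [S, β]⟩
  have hcard : Fintype.card ι = S.card := Fintype.card_subtype _
  have hmin : b (S.min' hS) = β := (Finset.mem_filter.1 (S.min'_mem hS)).2
  have key : (fun i : ι => v i) = 0 := by
    refine eq_zero_of_sum_mul_pow_eq_zero (y := fun i : ι => y i) (ε := fun i : ι => (i : Fin N))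
      (fun i j hij => Subtype.ext (hy _ _ (i.2.trans j.2.symm) hij)) (fun j => hy0 j)
      (fun i j hij => Subtype.ext (Fin.ext hij)) (S.min' hS : ℕ)
      (fun i => S.min'_le _ (Finset.mem_filter.2 ⟨Finset.mem_univ _, i.2⟩)) (fun i => ?_)
      (fun j => ?_)
    · have hsub : Finset.Icc (S.min' hS) (i : Fin N) ⊆ S := fun ρ hρ => by
        rw [Finset.mem_Icc] at hρ
        refine Finset.mem_filter.2 ⟨Finset.mem_univ _, le_antisymm ?_ ?_⟩
        · exact (hb hρ.2).trans_eq i.2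
        · exact hmin.symm.trans_le (hb hρ.1)
      have h1 := Finset.card_le_card hsub
      rw [Fin.card_Icc] at h1
      rw [hcard]
      omega
    · have h1 := congrFun hv0 j
      rw [vecMul, dotProduct] at h1
      have h2 : ∑ ρ, v ρ * initialMatrix k b y ρ j =
          (y j)⁻¹ ^ (k * β) * ∑ i : ι, v i * y j ^ ((i : Fin N) : ℕ) := by
        rw [Finset.mul_sum, ← Finset.sum_subtype (p := fun ρ => b ρ = β) S (by simp [S])
          (fun ρ => (y j)⁻¹ ^ (k * β) * (v ρ * y j ^ (ρ : ℕ))), Finset.sum_filter]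
        refine Finset.sum_congr rfl fun ρ _ => ?_
        simp only [initialMatrix, of_apply, j.2]
        split_ifs with hρ
        · have h3 : ρ / k ≤ β := hρ ▸ hlow ρ
          have h4 : k * β = k * (β - ρ / k) + k * (ρ / k) := by
            rw [← mul_add, Nat.sub_add_cancel h3]
          have h5 : y j ^ (ρ : ℕ) = y j ^ (ρ % k : ℕ) * y j ^ (k * (ρ / k)) := by
            rw [← pow_add, Nat.mod_add_div]
          have h6 : (y j)⁻¹ ^ (k * (ρ / k)) * y j ^ (k * (ρ / k)) = 1 := by
            rw [← mul_pow, inv_mul_cancel₀ (hy0 j), one_pow]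
          rw [h4, pow_add, h5]
          linear_combination (-(y j)⁻¹ ^ (k * (β - ρ / k)) * v ρ * y j ^ (ρ % k : ℕ)) * h6
        · simp
      rw [h2] at h1
      exact (mul_eq_zero.1 h1).resolve_left (pow_ne_zero _ (inv_ne_zero (hy0 j)))
  exact congrFun key ⟨ρ₀, rfl⟩

end Minor

end ConvCode

namespace ConvCode

/-! ### Sliding minors as polynomials in the weight -/

section Minor

variable {K : Type*} [Field K] {N : ℕ} {b : Fin N → ℕ} {y : Fin N → K} {k δ : ℕ}

/-- The square submatrix of the sliding generator matrix on the columns `(b j, y j)`. -/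
noncomputable def slidingMatrix (δ k : ℕ) (b : Fin N → ℕ) (y : Fin N → K) :
    Matrix (Fin N) (Fin N) K[X] :=
  of fun ρ j => slidingEntry δ k (y j) ρ (b j)

/-- The permutations picking only entries of the band of nonzero coefficients. -/
def InBand (δ k : ℕ) (b : Fin N → ℕ) (σ : Equiv.Perm (Fin N)) : Prop :=
  ∀ j, (σ j : ℕ) / k ≤ b j ∧ b j * k ≤ δ + σ j

/-- The weight of the term of a permutation in the determinant of the sliding matrix. -/
def permWeight (k : ℕ) (b : Fin N → ℕ) (σ : Equiv.Perm (Fin N)) : ℕ :=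
  ∑ j, rowWeight k ((σ j : ℕ) % k) (b j - (σ j : ℕ) / k)

lemma prod_slidingMatrix_of_inBand {σ : Equiv.Perm (Fin N)} (hσ : InBand δ k b σ) :
    ∏ j, slidingMatrix δ k b y (σ j) j =
      C (∏ j, (y j ^ (σ j % k : ℕ) * (y j)⁻¹ ^ (k * (b j - σ j / k)))) *
        X ^ permWeight k b σ := by
  rw [permWeight, map_prod, ← Finset.prod_pow_eq_pow_sum, ← Finset.prod_mul_distrib]
  refine Finset.prod_congr rfl fun j _ => ?_
  rw [slidingMatrix, of_apply, slidingEntry, if_pos (hσ j)]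

lemma prod_slidingMatrix_of_not_inBand {σ : Equiv.Perm (Fin N)} (hσ : ¬ InBand δ k b σ) :
    ∏ j, slidingMatrix δ k b y (σ j) j = 0 := by
  rw [InBand, not_forall] at hσ
  obtain ⟨j, hj⟩ := hσ
  exact Finset.prod_eq_zero (Finset.mem_univ j) (by rw [slidingMatrix, of_apply, slidingEntry,
    if_neg hj])

lemma two_mul_permWeight (hk : 0 < k) {σ : Equiv.Perm (Fin N)} (hσ : InBand δ k b σ) :
    (2 * permWeight k b σ : ℤ) = ∑ j, (k * b j * (b j + 1) : ℤ) +
      ∑ ρ : Fin N, (k * (ρ / k : ℕ) * ((ρ / k : ℕ) - 1) + 2 * (ρ % k : ℕ) * (ρ / k : ℕ) : ℤ)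
        - 2 * ∑ j, (b j * (σ j : ℕ) : ℤ) := by
  rw [permWeight, Nat.cast_sum, Finset.mul_sum, Finset.mul_sum, ← Equiv.sum_comp σ fun ρ : Fin N =>
    (k * (ρ / k : ℕ) * ((ρ / k : ℕ) - 1) + 2 * (ρ % k : ℕ) * (ρ / k : ℕ) : ℤ),
    ← Finset.sum_add_distrib, ← Finset.sum_sub_distrib]
  exact Finset.sum_congr rfl fun j _ => two_mul_rowWeight_sliding hk (hσ j).1

/-- By the rearrangement inequality, the minimal weight is only attained by the permutations that
preserve the blocks. -/
lemma comp_eq_of_permWeight_eq (hk : 0 < k) (hb : Monotone b) (h1 : InBand δ k b 1)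
    {σ : Equiv.Perm (Fin N)} (hσ : InBand δ k b σ) (h : permWeight k b σ = permWeight k b 1) :
    b ∘ σ = b := by
  have h2 := two_mul_permWeight hk hσ
  rw [h, two_mul_permWeight hk h1] at h2
  have h3 : ∑ j, (b j : ℤ) * ((σ j : ℕ) : ℤ) = ∑ j, (b j : ℤ) * ((j : ℕ) : ℤ) := by
    simp only [Equiv.Perm.coe_one, id_eq] at h2
    linarith
  have hmono : Monotone fun j => (b j : ℤ) := fun i j hij => Int.ofNat_le.2 (hb hij)
  have hmono' : Monotone fun j : Fin N => ((j : ℕ) : ℤ) := fun i j hij => Int.ofNat_le.2 hij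
  have h4 := (hmono.monovary hmono').sum_mul_comp_perm_eq_sum_mul_iff (σ := σ) |>.1 h3
  have h5 : Monotone (b ∘ σ.symm) := by
    intro i j hij
    rcases hij.eq_or_lt with rfl | hij
    · exact le_rfl
    · have := @h4 (σ.symm i) (σ.symm j) (by simpa using hij)
      simpa using this
  have h6 : b ∘ σ.symm = b ∘ (1 : Equiv.Perm (Fin N)) := Tuple.unique_monotone h5 hb
  funext j
  simpa using (congrFun h6 (σ j)).symm

/-- Block-preserving permutations all have the weight of the identity. By the equality case of
rearrangement no other in-band permutation has it, so nothing else enters this coefficient. -/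
lemma coeff_det_slidingMatrix (hk : 0 < k) (hb : Monotone b) (h1 : InBand δ k b 1) :
    (slidingMatrix δ k b y).det.coeff (permWeight k b 1) = (initialMatrix k b y).det := by
  rw [det_apply', det_apply', finsetSum_coeff]
  refine Finset.sum_congr rfl fun σ _ => ?_
  rw [coeff_intCast_mul]
  congr 1
  by_cases hσb : b ∘ σ = b
  · have hσ : ∀ j, b (σ j) = b j := fun j => congrFun hσb j
    have hσ' : InBand δ k b σ := fun j => by rw [← hσ j]; exact h1 (σ j)
    have hw : permWeight k b σ = permWeight k b 1 := by
      rw [permWeight, permWeight, ← Equiv.sum_comp σ (fun j => rowWeight k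
        (((1 : Equiv.Perm (Fin N)) j : ℕ) % k) (b j - ((1 : Equiv.Perm (Fin N)) j : ℕ) / k))]
      simp [hσ]
    rw [prod_slidingMatrix_of_inBand hσ', hw, coeff_C_mul_X_pow, if_pos rfl]
    refine Finset.prod_congr rfl fun j _ => ?_
    rw [initialMatrix, of_apply, if_pos (hσ j)]
  · have h0 : ∏ j, initialMatrix k b y (σ j) j = 0 := by
      obtain ⟨j, hj⟩ := Function.ne_iff.1 hσb
      exact Finset.prod_eq_zero (Finset.mem_univ j) (by exact if_neg hj)
    rw [h0]
    by_cases hσ : InBand δ k b σ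
    · rw [prod_slidingMatrix_of_inBand hσ, coeff_C_mul_X_pow,
        if_neg fun h => hσb (comp_eq_of_permWeight_eq hk hb h1 hσ h.symm)]
    · rw [prod_slidingMatrix_of_not_inBand hσ, coeff_zero]

lemma exists_inBand_of_coeff_det_ne_zero {m : ℕ} (h : (slidingMatrix δ k b y).det.coeff m ≠ 0) :
    ∃ σ, InBand δ k b σ ∧ permWeight k b σ = m := by
  rw [det_apply', finsetSum_coeff] at h
  obtain ⟨σ, -, hσ⟩ := Finset.exists_ne_zero_of_sum_ne_zero h
  rw [coeff_intCast_mul] at hσ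
  have hσ := right_ne_zero_of_mul hσ
  by_cases hσ' : InBand δ k b σ
  · rw [prod_slidingMatrix_of_inBand hσ', coeff_C_mul_X_pow] at hσ
    exact ⟨σ, hσ', by_contra fun hne => hσ (if_neg fun h => hne h.symm)⟩
  · rw [prod_slidingMatrix_of_not_inBand hσ', coeff_zero] at hσ
    exact absurd rfl hσ

lemma sum_range_mul_mod {M : Type*} [AddCommMonoid M] (f : ℕ → M) (k J : ℕ) :
    ∑ ρ ∈ Finset.range (J * k), f (ρ % k) = J • ∑ r ∈ Finset.range k, f r := by
  induction J with
  | zero => simp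
  | succ J ih =>
    rw [Nat.succ_mul, Finset.sum_range_add, ih, succ_nsmul]
    congr 1
    refine Finset.sum_congr rfl fun r hr => ?_
    rw [Nat.mul_add_mod', Nat.mod_eq_of_lt (Finset.mem_range.1 hr)]

/-- The weights of two terms of a minor differ little. -/
lemma permWeight_sub_le (hk : 0 < k) {J : ℕ} (hN : N = (J + 1) * k) (hJ : ∀ j, b j ≤ J)
    {σ τ : Equiv.Perm (Fin N)} (hσ : InBand δ k b σ) (hτ : InBand δ k b τ) :
    (4 * (permWeight k b σ - permWeight k b τ) : ℤ) ≤
      J * ∑ r ∈ Finset.range k, rowSpread k δ r := by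
  -- Twice the weight of a term, centered. The total correction depends only on the sums of `b j`
  -- and `ρ / k`, so differences of weights are unaffected and can be bounded row by row.
  let H : Fin N → ℕ → ℤ := fun ρ b =>
    ∑ j ∈ Finset.range (b - ρ / k), centeredStep k δ (ρ % k) j
  have hH : ∀ {σ : Equiv.Perm (Fin N)}, InBand δ k b σ → ∑ ρ, H ρ (b (σ.symm ρ)) =
      2 * permWeight k b σ - (δ + 1) * (∑ j, (b j : ℤ) - ∑ ρ : Fin N, (((ρ / k : ℕ)) : ℤ)) := by
    intro σ hσ
    rw [← Equiv.sum_comp σ, ← Equiv.sum_comp σ (fun ρ : Fin N => (((ρ / k : ℕ)) : ℤ)),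
      permWeight, Nat.cast_sum, Finset.mul_sum, ← Finset.sum_sub_distrib, Finset.mul_sum,
      ← Finset.sum_sub_distrib]
    refine Finset.sum_congr rfl fun j _ => ?_
    simp only [H, Equiv.symm_apply_apply]
    rw [sum_centeredStep (Nat.mod_lt _ hk), Nat.cast_sub (hσ j).1]
  have hle : ∀ ρ : Fin N, 2 * (H ρ (b (σ.symm ρ)) - H ρ (b (τ.symm ρ))) ≤
      if (ρ : ℕ) < J * k then rowSpread k δ (ρ % k) else 0 := by
    intro ρ
    have hM : ∀ {σ : Equiv.Perm (Fin N)}, InBand δ k b σ →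
        b (σ.symm ρ) - ρ / k ≤ (δ + ρ % k) / k := by
      intro σ hσ
      have h := (hσ (σ.symm ρ)).2
      rw [Equiv.apply_symm_apply] at h
      rw [Nat.le_div_iff_mul_le hk, Nat.sub_mul]
      have := Nat.div_add_mod (ρ : ℕ) k
      rw [mul_comm k] at this
      omega
    split_ifs with hρ
    · exact two_mul_partialSum_sub_le _ (hM hσ) (hM hτ)
    -- The last block row only sees coefficients of degree `0`, of weight `0`; this gives the factor
    -- `J` rather than `J + 1`.
    · have h : J ≤ (ρ : ℕ) / k := (Nat.le_div_iff_mul_le hk).2 (not_lt.1 hρ)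
      have h0 : ∀ j, b j - ρ / k = 0 := fun j => Nat.sub_eq_zero_of_le ((hJ j).trans h)
      simp [H, h0]
  have htotal : ∑ ρ ∈ Finset.range N, (if ρ < J * k then rowSpread k δ (ρ % k) else 0) =
      J * ∑ r ∈ Finset.range k, rowSpread k δ r := by
    rw [hN, Nat.succ_mul, Finset.sum_range_add,
      Finset.sum_congr rfl fun ρ hρ => if_pos (Finset.mem_range.1 hρ),
      Finset.sum_congr (s₁ := Finset.range k) rfl fun ρ _ => if_neg (by omega), sum_range_mul_mod,
      Finset.sum_const_zero, add_zero, nsmul_eq_mul]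
  have hsum := Finset.sum_le_sum fun ρ (_ : ρ ∈ Finset.univ) => hle ρ
  rw [← Finset.mul_sum, Finset.sum_sub_distrib, hH hσ, hH hτ,
    ← Finset.sum_range (fun ρ => if ρ < J * k then rowSpread k δ (ρ % k) else 0), htotal] at hsum
  linarith

/-- The columns of a nontrivial minor lie in the band of nonzero coefficients. -/
lemma inBand_one {n J : ℕ} (hk : 0 < k) (hkn : k < n) (hN : N = (J + 1) * k)
    (hJL : J ≤ δ / k + δ / (n - k)) (hb : Monotone b) (hJ : ∀ j, b j ≤ J) {c : Fin N → Fin n}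
    (hbc : ∀ i j, b i = b j → c i = c j → i = j)
    (hs : ∀ s ≤ J, (Finset.univ.filter fun j => b j < s).card ≤ s * k) : InBand δ k b 1 := by
  intro ρ
  simp only [Equiv.Perm.coe_one, id_eq]
  constructor
  · by_contra! h
    have hρJ : (ρ : ℕ) / k ≤ J := Nat.lt_succ_iff.1 ((Nat.div_lt_iff_lt_mul hk).2 (hN ▸ ρ.2))
    have h1 := hs _ hρJ
    have h2 : Finset.Iic ρ ⊆ Finset.univ.filter fun j => b j < ρ / k := fun j hj =>
      Finset.mem_filter.2 ⟨Finset.mem_univ _, (hb (Finset.mem_Iic.1 hj)).trans_lt h⟩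
    have h3 := Finset.card_le_card h2
    rw [Fin.card_Iic] at h3
    have := Nat.div_mul_le_self (ρ : ℕ) k
    omega
  -- The columns from `ρ` on lie in the blocks `b ρ, …, J`, each holding at most `n` columns.
  · have h1 : (Finset.Ici ρ).card ≤ ((Finset.Icc (b ρ) J) ×ˢ (Finset.univ : Finset (Fin n))).card :=
      Finset.card_le_card_of_injOn (fun j => (b j, c j))
        (fun j hj => by
          simpa using ⟨hb (Finset.mem_Ici.1 hj), hJ j⟩)
        (fun i _ j _ hij => hbc i j (Prod.ext_iff.1 hij).1 (Prod.ext_iff.1 hij).2)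
    rw [Fin.card_Ici, Finset.card_product, Nat.card_Icc, Finset.card_univ, Fintype.card_fin] at h1
    have hbJ := hJ ρ
    obtain ⟨i, hi⟩ := Nat.exists_eq_add_of_le hbJ
    obtain ⟨l, rfl⟩ := Nat.exists_eq_add_of_lt hkn
    rw [show k + l + 1 - k = l + 1 by omega] at hJL
    have h2 : b ρ * k ≤ ρ + (i + 1) * (l + 1) := by
      have e1 : (J + 1) * k = b ρ * k + (i + 1) * k := by rw [hi]; ring
      have e2 : (J + 1 - b ρ) * (k + l + 1) = (i + 1) * k + (i + 1) * (l + 1) := by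
        rw [show J + 1 - b ρ = i + 1 by omega]; ring
      omega
    -- Either `b ρ * k ≤ δ` at once, or at most `δ / (n - k)` blocks remain and the excess `(i + 1)
    -- (n - k)` is at most `δ`.
    rcases le_or_gt (b ρ) (δ / k) with h | h
    · have := (Nat.le_div_iff_mul_le hk).1 h
      omega
    · have h3 : i + 1 ≤ δ / (l + 1) := by omega
      have := (Nat.le_div_iff_mul_le (show 0 < l + 1 by omega)).1 h3
      omega

end Minor

end ConvCode

namespace ConvCode

/-! ### The weighted Reed-Solomon generator matrix -/

section Code

variable {K F : Type*} [Field K] [Field F] [Algebra K F] {n k δ : ℕ}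

/-- A polynomial whose terms have almost the same degree has no root of large degree, except for
zero. -/
lemma aeval_ne_zero_of_natDegree_lt {γ : F} (hγ : γ ≠ 0) {p : K[X]} (hp : p ≠ 0)
    (h : p.natDegree < p.natTrailingDegree + (minpoly K γ).natDegree) : aeval γ p ≠ 0 := by
  intro h0
  obtain ⟨f, hf⟩ : X ^ p.natTrailingDegree ∣ p :=
    X_pow_dvd_iff.2 fun d hd => coeff_eq_zero_of_lt_natTrailingDegree hd
  have hf0 : f ≠ 0 := by
    rintro rfl
    exact hp (by rw [hf, mul_zero])
  have hdeg : p.natDegree = p.natTrailingDegree + f.natDegree := by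
    conv_lhs => rw [hf]
    rw [natDegree_X_pow_mul _ hf0, add_comm]
  have h1 : aeval γ f = 0 := by
    rw [hf, map_mul, map_pow, aeval_X] at h0
    exact (mul_eq_zero.1 h0).resolve_left (pow_ne_zero _ hγ)
  have h2 := natDegree_le_of_dvd (minpoly.dvd K γ h1) hf0
  omega

/-- The generator matrix of a weighted Reed-Solomon convolutional code. -/
noncomputable def wrsMatrix (δ : ℕ) (x : Fin n → K) (γ : F) : Matrix (Fin k) (Fin n) F[X] :=
  of fun r c => ∑ i ∈ Finset.range ((δ + r) / k + 1),
    monomial i (algebraMap K F (x c ^ (r : ℕ) * (x c)⁻¹ ^ (k * i)) * γ ^ rowWeight k r i)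

lemma coeff_wrsMatrix (x : Fin n → K) (γ : F) (r : Fin k) (c : Fin n) (i : ℕ) :
    (wrsMatrix δ x γ r c).coeff i = if i ≤ (δ + r) / k then
      algebraMap K F (x c ^ (r : ℕ) * (x c)⁻¹ ^ (k * i)) * γ ^ rowWeight k r i else 0 := by
  simp [wrsMatrix, finsetSum_coeff, coeff_monomial]

lemma natDegree_wrsMatrix_le (x : Fin n → K) (γ : F) (r : Fin k) (c : Fin n) :
    (wrsMatrix δ x γ r c).natDegree ≤ (δ + r) / k :=
  natDegree_le_iff_coeff_eq_zero.2 fun i hi => by rw [coeff_wrsMatrix, if_neg hi.not_ge]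

/-- The entry in position `(ρ, (b, c))` of the truncated sliding generator matrix: row `ρ` is row
`ρ % k` of block row `ρ / k`. -/
noncomputable def slidingCoeff (hk : 0 < k) (G : Matrix (Fin k) (Fin n) F[X]) (ρ b : ℕ)
    (c : Fin n) : F :=
  if ρ / k ≤ b then (G ⟨ρ % k, Nat.mod_lt _ hk⟩ c).coeff (b - ρ / k) else 0

lemma slidingCoeff_wrsMatrix (hk : 0 < k) (x : Fin n → K) (γ : F) (ρ b : ℕ) (c : Fin n) :
    slidingCoeff hk (wrsMatrix δ x γ) ρ b c = aeval γ (slidingEntry δ k (x c) ρ b) := by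
  rw [slidingCoeff, slidingEntry, coeff_wrsMatrix]
  have hiff : ρ / k ≤ b → (b - ρ / k ≤ (δ + ρ % k) / k ↔ b * k ≤ δ + ρ) := fun h => by
    rw [Nat.le_div_iff_mul_le hk, Nat.sub_mul]
    have := Nat.div_add_mod ρ k
    have := Nat.mul_le_mul_right k h
    rw [mul_comm k] at *
    omega
  by_cases h : ρ / k ≤ b
  · by_cases h' : b * k ≤ δ + ρ
    · rw [if_pos h, if_pos ((hiff h).2 h'), if_pos ⟨h, h'⟩, map_mul (aeval γ), aeval_C, map_pow (aeval γ),
        aeval_X]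
    · rw [if_pos h, if_neg (mt (hiff h).1 h'), if_neg fun h0 => h' h0.2, map_zero]
  · rw [if_neg h, if_neg fun h0 => h h0.1, map_zero]

/-- All nontrivial minors of the truncated sliding generator matrices up to block column `L` are
nonzero. -/
def NontrivialMinorsNeZero (hk : 0 < k) (G : Matrix (Fin k) (Fin n) F[X]) (L : ℕ) : Prop :=
  ∀ J ≤ L, ∀ N, N = (J + 1) * k → ∀ (b : Fin N → ℕ) (c : Fin N → Fin n), Monotone b →
    (∀ j, b j ≤ J) → (∀ i j, b i = b j → c i = c j → i = j) →
    (∀ s ≤ J, (Finset.univ.filter fun j => b j < s).card ≤ s * k) →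
    (of fun (ρ : Fin N) j => slidingCoeff hk G ρ (b j) (c j)).det ≠ 0

lemma nontrivialMinorsNeZero_wrsMatrix (hk : 0 < k) (hkn : k < n) {x : Fin n → K}
    (hx : Function.Injective x) (hx0 : ∀ c, x c ≠ 0) {γ : F} (hγ : γ ≠ 0)
    (hdeg : ((δ / k + δ / (n - k) : ℕ) : ℤ) * ∑ r ∈ Finset.range k, rowSpread k δ r <
      4 * (minpoly K γ).natDegree) :
    NontrivialMinorsNeZero hk (wrsMatrix δ x γ) (δ / k + δ / (n - k)) := by
  intro J hJL N hN b c hb hJ hbc hs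
  have h1 := inBand_one hk hkn hN hJL hb hJ hbc hs
  let y : Fin N → K := fun j => x (c j)
  have hmap : (of fun (ρ : Fin N) j => slidingCoeff hk (wrsMatrix δ x γ) ρ (b j) (c j)) =
      (aeval (R := K) γ).mapMatrix (slidingMatrix δ k b y) := by
    ext ρ j
    simp only [of_apply, slidingCoeff_wrsMatrix, AlgHom.mapMatrix_apply, map_apply, slidingMatrix,
      y]
  rw [hmap, ← AlgHom.map_det]
  have hp : (slidingMatrix δ k b y).det ≠ 0 := by
    intro h
    have h2 := coeff_det_slidingMatrix (y := y) hk hb h1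
    rw [h, coeff_zero] at h2
    exact det_initialMatrix_ne_zero hb (fun i j hij hy => hbc i j hij (hx hy)) (fun j => hx0 _)
      (fun ρ => (h1 ρ).1) h2.symm
  refine aeval_ne_zero_of_natDegree_lt hγ hp ?_
  -- The degree and the trailing degree are both weights of in-band permutations.
  obtain ⟨σ, hσ, hσw⟩ := exists_inBand_of_coeff_det_ne_zero (δ := δ) (k := k) (b := b) (y := y)
    (mt leadingCoeff_eq_zero.1 hp)
  obtain ⟨τ, hτ, hτw⟩ := exists_inBand_of_coeff_det_ne_zero (δ := δ) (k := k) (b := b) (y := y)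
    (mt trailingCoeff_eq_zero.1 hp)
  have h3 := permWeight_sub_le hk hN hJ hσ hτ
  have h4 : (J : ℤ) * ∑ r ∈ Finset.range k, rowSpread k δ r ≤
      ((δ / k + δ / (n - k) : ℕ) : ℤ) * ∑ r ∈ Finset.range k, rowSpread k δ r :=
    mul_le_mul_of_nonneg_right (Int.ofNat_le.2 hJL)
      (Finset.sum_nonneg fun r _ => rowSpread_nonneg k δ r)
  rw [hσw, hτw] at h3
  omega

lemma natDegree_prod_le_sum {R ι : Type*} [CommRing R] (s : Finset ι) {f : ι → R[X]} {d : ι → ℕ}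
    (h : ∀ i ∈ s, (f i).natDegree ≤ d i) : (∏ i ∈ s, f i).natDegree ≤ ∑ i ∈ s, d i :=
  (natDegree_prod_le s f).trans (Finset.sum_le_sum h)

lemma coeff_prod_sum {R ι : Type*} [CommRing R] (s : Finset ι) {f : ι → R[X]} {d : ι → ℕ}
    (h : ∀ i ∈ s, (f i).natDegree ≤ d i) :
    (∏ i ∈ s, f i).coeff (∑ i ∈ s, d i) = ∏ i ∈ s, (f i).coeff (d i) := by
  classical
  induction s using Finset.induction_on with
  | empty => simp
  | insert a s ha ih =>
    rw [Finset.forall_mem_insert] at h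
    rw [Finset.prod_insert ha, Finset.sum_insert ha, Finset.prod_insert ha,
      coeff_mul_add_eq_of_natDegree_le h.1 (natDegree_prod_le_sum s h.2), ih h.2]

lemma natDegree_det_le_sum {R : Type*} [CommRing R] {A : Matrix (Fin k) (Fin k) R[X]} {d : Fin k → ℕ}
    (h : ∀ r c, (A r c).natDegree ≤ d r) : A.det.natDegree ≤ ∑ r, d r := by
  rw [det_apply']
  refine natDegree_sum_le_of_forall_le _ _ fun σ _ => ?_
  rw [← Equiv.sum_comp σ d]
  refine natDegree_mul_le_of_le (m := 0) (by simp) ?_ |>.trans (by rw [zero_add])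
  exact natDegree_prod_le_sum _ fun i _ => h _ _

lemma coeff_det_sum {R : Type*} [CommRing R] {A : Matrix (Fin k) (Fin k) R[X]} {d : Fin k → ℕ}
    (h : ∀ r c, (A r c).natDegree ≤ d r) :
    A.det.coeff (∑ r, d r) = (of fun r c => (A r c).coeff (d r)).det := by
  rw [det_apply', det_apply', finsetSum_coeff]
  refine Finset.sum_congr rfl fun σ _ => ?_
  rw [coeff_intCast_mul, ← Equiv.sum_comp σ d, coeff_prod_sum _ fun i _ => h _ _]
  rfl

/-- The row degree bounds `⌊(δ + r)/k⌋` sum to `δ`. The bound is attained on the first `k` columns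
because the matrix of leading row coefficients is a generalized Vandermonde matrix up to row and
column scaling. -/
lemma maxMinorDegree_wrsMatrix (hk : 0 < k) (hkn : k < n) {x : Fin n → K}
    (hx : Function.Injective x) (hx0 : ∀ c, x c ≠ 0) {γ : F} (hγ : γ ≠ 0) :
    maxMinorDegree (wrsMatrix (k := k) δ x γ) = δ := by
  have hsum : ∑ r : Fin k, (δ + r) / k = δ := by
    rw [← Finset.sum_range fun r => (δ + r) / k]
    exact sum_div_residues hk δ
  have hdeg : ∀ (e : Fin k ↪o Fin n) (r c : Fin k),
      ((wrsMatrix (k := k) δ x γ).submatrix id e r c).natDegree ≤ (δ + r) / k :=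
    fun e r c => natDegree_wrsMatrix_le _ _ _ _
  refine le_antisymm (Finset.sup_le fun e _ => ?_) ?_
  · exact (natDegree_det_le_sum (hdeg e)).trans hsum.le
  · let e : Fin k ↪o Fin n := Fin.castLEOrderEmb hkn.le
    refine le_trans ?_ (Finset.le_sup (Finset.mem_univ e))
    refine le_natDegree_of_ne_zero ?_
    have h := coeff_det_sum (hdeg e)
    rw [hsum] at h
    rw [h]
    intro h0
    obtain ⟨v, hv, hv0⟩ := exists_vecMul_eq_zero_iff.2 h0
    refine hv ?_
    have key : (fun r : Fin k => v r * γ ^ rowWeight k r ((δ + r) / k)) = 0 := by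
      -- The factor `x^(-(k-1))` makes all exponents of `x⁻¹` natural numbers. If `d` is the
      -- remainder of `δ + r` modulo `k`, the exponent is `δ + (k - 1 - d)`, in the window of length
      -- `k` starting at `δ`.
      refine eq_zero_of_sum_mul_pow_eq_zero (y := fun c => (algebraMap K F (x (e c)))⁻¹)
        (ε := fun r : Fin k => k * ((δ + r) / k) + (k - 1 - r)) (fun c c' hc => ?_) (fun c => ?_)
        (fun r r' hr => ?_) δ (fun r => ?_) (fun r => ?_) (fun c => ?_)
      · exact e.injective (hx ((algebraMap K F).injective (inv_injective hc)))
      · exact inv_ne_zero ((_root_.map_ne_zero _).2 (hx0 _))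
      · have h1 := congrArg (· % k) hr
        simp only [Nat.mul_add_mod] at h1
        rw [Nat.mod_eq_of_lt (by omega), Nat.mod_eq_of_lt (by omega)] at h1
        omega
      · have := Nat.div_add_mod (δ + r) k
        have := Nat.mod_lt (δ + r) hk
        omega
      · have := Nat.div_add_mod (δ + r) k
        rw [Fintype.card_fin]
        omega
      · have h1 := congrFun hv0 c
        rw [vecMul, dotProduct, Pi.zero_apply] at h1
        rw [← mul_zero ((algebraMap K F (x (e c)))⁻¹ ^ (k - 1)), ← h1,
          Finset.mul_sum]
        refine Finset.sum_congr rfl fun r _ => ?_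
        rw [of_apply, submatrix_apply, id, coeff_wrsMatrix, if_pos le_rfl, map_mul, map_pow,
          map_pow, map_inv₀]
        have hz : algebraMap K F (x (e c)) ≠ 0 := (_root_.map_ne_zero _).2 (hx0 _)
        generalize algebraMap K F (x (e c)) = z at hz
        have h2 : z⁻¹ ^ (k - 1) = z⁻¹ ^ (k - 1 - r) * z⁻¹ ^ (r : ℕ) := by
          rw [← pow_add]; congr 1; omega
        have h3 : z⁻¹ ^ (r : ℕ) * z ^ (r : ℕ) = 1 := by
          rw [← mul_pow, inv_mul_cancel₀ hz, one_pow]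
        rw [h2, pow_add]
        linear_combination (-v r * γ ^ rowWeight k r ((δ + r) / k) * z⁻¹ ^ (k - 1 - r) *
          z⁻¹ ^ (k * ((δ + r) / k))) * h3
    funext r
    exact (mul_eq_zero.1 (congrFun key r)).resolve_right (pow_ne_zero _ hγ)

end Code

end ConvCode

namespace ConvCode

/-! ### From nonzero minors to column distances -/

section ColumnDistance

variable {F : Type*} [Field F] {n k : ℕ}

/-- The positions of the zeros of `v_0, …, v_j`. -/
noncomputable def zeroPositions (v : Fin n → F[X]) (j : ℕ) : Finset (ℕ × Fin n) :=
  open Classical in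
  (Finset.range (j + 1) ×ˢ Finset.univ).filter fun p => (v p.2).coeff p.1 = 0

lemma mem_zeroPositions {v : Fin n → F[X]} {j : ℕ} {p : ℕ × Fin n} :
    p ∈ zeroPositions v j ↔ p.1 ≤ j ∧ (v p.2).coeff p.1 = 0 := by
  simp [zeroPositions]

lemma truncWeight_add_card_zeroPositions (v : Fin n → F[X]) (j : ℕ) :
    truncWeight v j + (zeroPositions v j).card = (j + 1) * n := by
  classical
  have h : truncWeight v j =
      ((Finset.range (j + 1) ×ˢ Finset.univ).filter fun p : ℕ × Fin n =>
        ¬ (v p.2).coeff p.1 = 0).card := by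
    rw [Finset.card_filter, Finset.sum_product, truncWeight]
    refine Finset.sum_congr rfl fun i _ => ?_
    rw [← Finset.card_filter, hammingNorm]
    congr
  rw [h, zeroPositions, add_comm, Finset.card_filter_add_card_filter_not, Finset.card_product]
  simp

/-- The coefficients of a codeword in terms of those of the message. -/
lemma coeff_vecMul_eq_sum (hk : 0 < k) (G : Matrix (Fin k) (Fin n) F[X]) (u : Fin k → F[X])
    {J b N : ℕ} (hN : N = (J + 1) * k) (hb : b ≤ J) (c : Fin n) :
    ((u ᵥ* G) c).coeff b = ∑ ρ : Fin N,
      (u ⟨ρ % k, Nat.mod_lt _ hk⟩).coeff (ρ / k) * slidingCoeff hk G ρ b c := by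
  subst hN
  rw [vecMul, dotProduct, finsetSum_coeff, ← Equiv.sum_comp finProdFinEquiv,
    Fintype.sum_prod_type_right]
  refine Finset.sum_congr rfl fun r _ => ?_
  have h1 : ∀ a : Fin (J + 1), ((finProdFinEquiv (a, r) : Fin ((J + 1) * k)) : ℕ) / k = a :=
    fun a => by simp [finProdFinEquiv, Nat.add_mul_div_left _ _ hk, Nat.div_eq_of_lt r.2]
  have h2 : ∀ a : Fin (J + 1), ((finProdFinEquiv (a, r) : Fin ((J + 1) * k)) : ℕ) % k = r :=
    fun a => by simp [finProdFinEquiv, Nat.mod_eq_of_lt r.2]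
  simp only [slidingCoeff, h1, h2]
  rw [coeff_mul, Finset.Nat.sum_antidiagonal_eq_sum_range_succ
    (fun i j => (u r).coeff i * (G r c).coeff j),
    ← Finset.sum_range (fun a => (u r).coeff a * if a ≤ b then (G r c).coeff (b - a) else 0)]
  rw [← Finset.sum_subset (Finset.range_subset_range.2 (Nat.succ_le_succ hb))]
  · refine Finset.sum_congr rfl fun a ha => ?_
    rw [if_pos (Nat.lt_succ_iff.1 (Finset.mem_range.1 ha))]
  · intro a _ ha
    rw [if_neg (by simpa using ha), mul_zero]

/-- A codeword with at least `k` zeros per block in some window starts with zero. -/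
lemma coeffVec_zero_eq_zero_of_card_zeroPositions (hk : 0 < k) {G : Matrix (Fin k) (Fin n) F[X]}
    {L : ℕ} (hG : NontrivialMinorsNeZero hk G L) {j : ℕ} (hj : j ≤ L) (u : Fin k → F[X])
    (h : (j + 1) * k ≤ (zeroPositions (u ᵥ* G) j).card) : coeffVec (u ᵥ* G) 0 = 0 := by
  classical
  have hex : ∃ J, (J + 1) * k ≤ (zeroPositions (u ᵥ* G) J).card := ⟨j, h⟩
  -- Minimality of `J` bounds the number of zeros in every shorter window, which is the
  -- nontriviality condition on the columns of the minor.
  obtain ⟨J, hJ, hmin⟩ : ∃ J, (J + 1) * k ≤ (zeroPositions (u ᵥ* G) J).card ∧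
      ∀ m < J, (zeroPositions (u ᵥ* G) m).card < (m + 1) * k :=
    ⟨Nat.find hex, Nat.find_spec hex, fun m hm => not_le.1 (Nat.find_min hex hm)⟩
  have hJj : J ≤ j := by
    by_contra! hlt
    exact absurd h (hmin j hlt).not_ge
  obtain ⟨Z, hZ, hZcard⟩ := Finset.exists_subset_card_eq hJ
  -- Lexicographic order makes the block index monotone along the enumeration.
  let Z' : Finset (ℕ ×ₗ Fin n) := Z.map toLex.toEmbedding
  have hZ'card : Z'.card = (J + 1) * k := by rw [Finset.card_map, hZcard]
  let f := Z'.orderEmbOfFin hZ'card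
  let b : Fin ((J + 1) * k) → ℕ := fun i => (ofLex (f i)).1
  let c : Fin ((J + 1) * k) → Fin n := fun i => (ofLex (f i)).2
  have hf : ∀ i, ofLex (f i) ∈ Z := fun i => by
    obtain ⟨p, hp, hp'⟩ := Finset.mem_map.1 (Z'.orderEmbOfFin_mem hZ'card i)
    rw [show f i = toLex p from hp'.symm]
    exact hp
  have hzero : ∀ i, b i ≤ J ∧ ((u ᵥ* G) (c i)).coeff (b i) = 0 := fun i =>
    mem_zeroPositions.1 (hZ (hf i))
  have hbc : ∀ i i', b i = b i' → c i = c i' → i = i' := fun i i' h1 h2 =>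
    f.injective (ofLex.injective (Prod.ext h1 h2))
  have hdet := hG J (hJj.trans hj) _ rfl b c
    (fun i i' hii' => Prod.Lex.monotone_fst _ _ (f.monotone hii')) (fun i => (hzero i).1) hbc
    (fun s hs => by
      rcases s with _ | m
      · simp
      · refine le_trans ?_ (hmin m hs).le
        refine Finset.card_le_card_of_injOn (fun i => (b i, c i)) (fun i hi => ?_)
          (fun i _ i' _ hii' => hbc i i' (Prod.ext_iff.1 hii').1 (Prod.ext_iff.1 hii').2)
        have hi := (Finset.mem_filter.1 (Finset.mem_coe.1 hi)).2
        exact mem_zeroPositions.2 ⟨Nat.lt_succ_iff.1 hi, (hzero i).2⟩)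
  have hu : (fun ρ : Fin ((J + 1) * k) =>
      (u ⟨ρ % k, Nat.mod_lt _ hk⟩).coeff (ρ / k)) = 0 := by
    refine eq_zero_of_vecMul_eq_zero hdet (funext fun i => ?_)
    have h1 := coeff_vecMul_eq_sum hk G u rfl (hzero i).1 (c i)
    rw [(hzero i).2] at h1
    exact h1.symm
  funext c
  rw [coeffVec, coeff_vecMul_eq_sum hk G u (J := 0) rfl le_rfl]
  refine Finset.sum_eq_zero fun ρ _ => ?_
  have hρ : (ρ : ℕ) < k := lt_of_lt_of_eq ρ.2 (by ring)
  have h2 := congrFun hu ⟨ρ, hρ.trans_le (Nat.le_mul_of_pos_left _ (Nat.succ_pos J))⟩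
  simp only [Pi.zero_apply] at h2
  rw [h2, zero_mul]

/-- The leading `k × k` minor has a nonzero constant term. -/
lemma coeff_zero_det_ne_zero (hk : 0 < k) (hkn : k < n) {G : Matrix (Fin k) (Fin n) F[X]} {L : ℕ}
    (hG : NontrivialMinorsNeZero hk G L) :
    (G.submatrix id (Fin.castLE hkn.le)).det.coeff 0 ≠ 0 := by
  have h := hG 0 (Nat.zero_le L) k (by ring) (fun _ => 0) (Fin.castLE hkn.le)
    monotone_const (fun _ => le_rfl) (fun i j _ hij => Fin.castLE_injective _ hij) (by simp)
  rw [← constantCoeff_apply, RingHom.map_det]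
  convert h using 2
  ext ρ j
  simp only [RingHom.mapMatrix_apply, map_apply, submatrix_apply, id, of_apply, slidingCoeff,
    constantCoeff_apply]
  simp [Nat.div_eq_of_lt ρ.2, Nat.mod_eq_of_lt ρ.2]

/-- There is a message whose codeword agrees on the first `k` columns with a given vector up to
the order `j`. -/
lemma exists_message (hk : 0 < k) (hkn : k < n) {G : Matrix (Fin k) (Fin n) F[X]} {L : ℕ}
    (hG : NontrivialMinorsNeZero hk G L) (w : Fin k → F[X]) (j : ℕ) :
    ∃ u : Fin k → F[X], ∀ c, X ^ (j + 1) ∣ (u ᵥ* G) (Fin.castLE hkn.le c) - w c := by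
  set A := G.submatrix id (Fin.castLE hkn.le) with hA
  have h0 : A.det.coeff 0 ≠ 0 := coeff_zero_det_ne_zero hk hkn hG
  have hcop : IsCoprime A.det (X ^ (j + 1)) := by
    refine IsCoprime.pow_right ?_
    rw [isCoprime_comm, irreducible_X.coprime_iff_not_dvd, X_dvd_iff]
    exact h0
  -- Here `p` inverts `det A` modulo `X^(j+1)`, so `p • adj A` inverts `A` to that order.
  obtain ⟨p, p', hp⟩ := hcop
  refine ⟨p • (w ᵥ* A.adjugate), fun c => ?_⟩
  have h1 : ((p • (w ᵥ* A.adjugate)) ᵥ* G) (Fin.castLE hkn.le c) =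
      ((p • (w ᵥ* A.adjugate)) ᵥ* A) c := rfl
  rw [h1, smul_vecMul, vecMul_vecMul, adjugate_mul, vecMul_smul, vecMul_one]
  refine ⟨-(p' * w c), ?_⟩
  simp only [Pi.smul_apply, smul_eq_mul]
  linear_combination w c * hp

/-- A lighter truncation would have at least `(j + 1) k` zeros. Equality is attained by a codeword
agreeing with `(1, 0, …, 0)` on the first `k` columns up to order `j`, which has `(j + 1) k - 1`
zeros there. -/
lemma columnDistance_eq (hk : 0 < k) (hkn : k < n) {G : Matrix (Fin k) (Fin n) F[X]} {L : ℕ}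
    (hG : NontrivialMinorsNeZero hk G L) {C : Submodule F[X] (Fin n → F[X])}
    (hC : (C : Set (Fin n → F[X])) = Set.range fun u => u ᵥ* G) {j : ℕ} (hj : j ≤ L) :
    columnDistance C j = (n - k) * (j + 1) + 1 := by
  have hmul : (j + 1) * n = (n - k) * (j + 1) + (j + 1) * k := by
    rw [mul_comm (n - k), ← mul_add, Nat.sub_add_cancel hkn.le]
  have hlow : ∀ v ∈ C, coeffVec v 0 ≠ 0 → (n - k) * (j + 1) + 1 ≤ truncWeight v j := by
    intro v hv hv0
    obtain ⟨u, rfl⟩ := hC.subset hv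
    have h1 := truncWeight_add_card_zeroPositions (u ᵥ* G) j
    by_contra! h2
    exact hv0 (coeffVec_zero_eq_zero_of_card_zeroPositions hk hG hj u (by omega))
  obtain ⟨u, hu⟩ := exists_message hk hkn hG (Pi.single ⟨0, hk⟩ 1) j
  have hcoeff : ∀ c : Fin k, ∀ i ≤ j, ((u ᵥ* G) (Fin.castLE hkn.le c)).coeff i =
      ((Pi.single ⟨0, hk⟩ 1 : Fin k → F[X]) c).coeff i := fun c i hi => by
    have h1 := X_pow_dvd_iff.1 (hu c) i (Nat.lt_succ_of_le hi)
    rwa [coeff_sub, sub_eq_zero] at h1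
  have hmem : u ᵥ* G ∈ C := hC.superset ⟨u, rfl⟩
  have hne : coeffVec (u ᵥ* G) 0 ≠ 0 := fun h => by
    have h1 := hcoeff ⟨0, hk⟩ 0 (Nat.zero_le j)
    rw [Pi.single_eq_same, coeff_one_zero] at h1
    exact one_ne_zero (h1.symm.trans (congrFun h _))
  have hup : truncWeight (u ᵥ* G) j ≤ (n - k) * (j + 1) + 1 := by
    have h1 := truncWeight_add_card_zeroPositions (u ᵥ* G) j
    have h2 : ((Finset.range (j + 1) ×ˢ (Finset.univ : Finset (Fin k))).erase
        (0, ⟨0, hk⟩)).card ≤ (zeroPositions (u ᵥ* G) j).card := by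
      refine Finset.card_le_card_of_injOn (fun p => (p.1, Fin.castLE hkn.le p.2)) ?_ ?_
      · rintro ⟨i, c⟩ hp
        simp only [Finset.coe_erase, Finset.coe_product, Set.mem_sdiff, Set.mem_prod,
          Finset.mem_coe, Finset.mem_range, Set.mem_singleton_iff, Prod.mk.injEq] at hp
        refine mem_zeroPositions.2 ⟨Nat.lt_succ_iff.1 hp.1.1, ?_⟩
        rw [hcoeff c i (Nat.lt_succ_iff.1 hp.1.1)]
        by_cases hc : c = ⟨0, hk⟩
        · subst hc
          rw [Pi.single_eq_same, coeff_one, if_neg fun hi => hp.2 ⟨hi, rfl⟩]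
        · rw [Pi.single_eq_of_ne hc, coeff_zero]
      · rintro ⟨i, c⟩ _ ⟨i', c'⟩ _ h
        simp only [Prod.mk.injEq] at h
        rw [h.1, Fin.castLE_injective _ h.2]
    rw [Finset.card_erase_of_mem (by simp), Finset.card_product, Finset.card_range,
      Finset.card_univ, Fintype.card_fin] at h2
    omega
  have hset : truncWeight (u ᵥ* G) j ∈
      {w : ℕ | ∃ v ∈ C, coeffVec v 0 ≠ 0 ∧ truncWeight v j = w} := ⟨_, hmem, hne, rfl⟩
  refine le_antisymm ((Nat.sInf_le hset).trans hup) (le_csInf ⟨_, hset⟩ ?_)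
  rintro w ⟨v, hv, hv0, rfl⟩
  exact hlow v hv hv0

lemma linearIndependent_row (hk : 0 < k) (hkn : k < n) {G : Matrix (Fin k) (Fin n) F[X]} {L : ℕ}
    (hG : NontrivialMinorsNeZero hk G L) : LinearIndependent F[X] G.row := by
  have h0 := coeff_zero_det_ne_zero hk hkn hG
  have hdet : (G.submatrix id (Fin.castLE hkn.le)).det ≠ 0 := fun h => h0 (by rw [h, coeff_zero])
  have h1 := linearIndependent_rows_of_det_ne_zero hdet
  exact LinearIndependent.of_comp (LinearMap.funLeft F[X] F[X] (Fin.castLE hkn.le)) h1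

/-- A generator matrix all of whose nontrivial sliding minors are nonzero generates an MDP code. -/
theorem isMDPCode_of_nontrivialMinorsNeZero {δ : ℕ} (hk : 0 < k) (hkn : k < n)
    {G : Matrix (Fin k) (Fin n) F[X]}
    (hG : NontrivialMinorsNeZero hk G (δ / k + δ / (n - k))) (hδ : maxMinorDegree G = δ) :
    IsMDPCode n k δ (LinearMap.range G.vecMulLinear) := by
  have hC : ((LinearMap.range G.vecMulLinear : Submodule F[X] (Fin n → F[X])) :
      Set (Fin n → F[X])) = Set.range fun u => u ᵥ* G := rfl
  exact ⟨⟨G, ⟨linearIndependent_row hk hkn hG, hC⟩, hδ⟩,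
    fun j hj => columnDistance_eq hk hkn hG hC hj⟩

end ColumnDistance

end ConvCode

namespace ConvCode

/-! ### Numerical bounds -/

section Bounds

variable {d k t l S : ℝ}

lemma mul_le_of_le_div_add_div (hd : 0 ≤ d) (ht : 0 < t) (htk : t ≤ k) (hl : l ≤ d / k + d / t)
    (hS : 0 ≤ S) {B : ℝ} (hB : (1 + t / k) * S ≤ B) : l * S ≤ d / t * B := by
  have hk : 0 < k := ht.trans_le htk
  calc l * S ≤ (d / k + d / t) * S := mul_le_mul_of_nonneg_right hl hS
    _ = d / t * ((1 + t / k) * S) := by field_simp; ring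
    _ ≤ d / t * B := mul_le_mul_of_nonneg_left hB (by positivity)

lemma one_add_div_mul_le (hk : 0 < k) (ht : 0 ≤ t) (hS : 2 * S ≤ d ^ 2 + 2 * (d * k)) :
    (1 + t / k) * S ≤ (1 + t / k) * (d ^ 2 / 2) + (k + t) * d := by
  calc (1 + t / k) * S ≤ (1 + t / k) * (d ^ 2 / 2 + d * k) :=
        mul_le_mul_of_nonneg_left (by linarith) (by positivity)
    _ = _ := by field_simp

lemma mul_le_first_bound (hd : 0 ≤ d) (ht : 0 < t) (htk : t ≤ k) (hl : l ≤ d / k + d / t)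
    (hS : 0 ≤ S) (hS1 : S ≤ d ^ 2) (hS2 : 2 * S ≤ d ^ 2 + 2 * (d * k)) :
    l * S ≤ 4 * (d ^ 3 / (3 * t) + 3 * d ^ 2 / 4 + d * t / 12) := by
  have hk : 0 < k := ht.trans_le htk
  have hy : t / k ≤ 1 := (div_le_one hk).2 htk
  have h2 := one_add_div_mul_le hk ht.le hS2
  have hdt : 0 ≤ d * t := mul_nonneg hd ht.le
  have key : (1 + t / k) * S ≤ 4 / 3 * d ^ 2 + 3 * (d * t) + t ^ 2 / 3 := by
    -- For `k ≤ 2t` the half-square bound on `S` suffices, for `k ≥ 3t` the bound `S ≤ d²`. In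
    -- between, `S ≤ d²` works exactly while `3/2 d² ≤ 4/3 d² + 3 d t`, that is, up to `d = 18 t`;
    -- beyond that the half-square bound takes over.
    rcases le_total k (2 * t) with h | h
    · nlinarith [mul_le_mul_of_nonneg_right hy (sq_nonneg d), mul_le_mul_of_nonneg_right h hd]
    have hy2 : t / k ≤ 1 / 2 := by rw [div_le_iff₀ hk]; linarith
    rcases le_total (3 * t) k with h' | h'
    · have hy3 : t / k ≤ 1 / 3 := by rw [div_le_iff₀ hk]; linarith
      nlinarith [mul_le_mul_of_nonneg_right hy3 hS, sq_nonneg t]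
    rcases le_total d (18 * t) with hd' | hd'
    · nlinarith [mul_le_mul_of_nonneg_right hy2 hS, sq_nonneg t,
        mul_le_mul_of_nonneg_left hd' hd]
    · nlinarith [mul_le_mul_of_nonneg_right hy2 (sq_nonneg d), sq_nonneg t,
        mul_le_mul_of_nonneg_left hd' hd, mul_le_mul_of_nonneg_right h' hd]
  refine (mul_le_of_le_div_add_div hd ht htk hl hS key).trans_eq ?_
  field_simp
  ring

lemma mul_le_second_bound (hd : 0 ≤ d) (ht : 0 < t) (htk : t ≤ k) (hl : l ≤ d / k + d / t)
    (hS : 0 ≤ S) (hS1 : S ≤ d ^ 2) (hS2 : 2 * S ≤ d ^ 2 + 2 * (d * k)) :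
    l * S ≤ 4 * (11 / 24 * (d ^ 3 / t + d * t)) := by
  have hk : 0 < k := ht.trans_le htk
  have hy : t / k ≤ 1 := (div_le_one hk).2 htk
  have h2 := one_add_div_mul_le hk ht.le hS2
  have key : (1 + t / k) * S ≤ 11 / 6 * (d ^ 2 + t ^ 2) := by
    -- At `k = 6/5 t` the factor `1 + t/k` equals `11/6`, so above it `S ≤ d²` is enough. Below it,
    -- a positive definite quadratic form remains, whose minimum in `d` is at `1.32 t`.
    rcases le_total k (6 / 5 * t) with h | h
    · nlinarith [mul_le_mul_of_nonneg_right hy (sq_nonneg d), mul_le_mul_of_nonneg_right h hd,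
        sq_nonneg (d - 1.32 * t)]
    · have hy2 : t / k ≤ 5 / 6 := by rw [div_le_iff₀ hk]; linarith
      nlinarith [mul_le_mul_of_nonneg_right hy2 hS, sq_nonneg t]
  refine (mul_le_of_le_div_add_div hd ht htk hl hS key).trans_eq ?_
  field_simp
  ring

end Bounds

/-! ### Choice of the fields and of the weight -/

section Existence

/-- Weighted Reed-Solomon convolutional codes of degree `δ` are MDP if the weight `γ` has a large
degree over the field `K` of the evaluation points. -/
theorem exists_isMDPCode_of_lt {K F : Type*} [Field K] [Fintype K] [Field F] [Algebra K F]
    {n k δ : ℕ} (hk : 0 < k) (hkn : k < n) (hK : n < Fintype.card K) {γ : F} (hγ : γ ≠ 0)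
    (hdeg : ((δ / k + δ / (n - k) : ℕ) : ℤ) * ∑ r ∈ Finset.range k, rowSpread k δ r <
      4 * (minpoly K γ).natDegree) :
    ∃ C : Submodule F[X] (Fin n → F[X]), IsMDPCode n k δ C := by
  classical
  obtain ⟨x⟩ : Nonempty (Fin n ↪ Kˣ) := Function.Embedding.nonempty_of_card_le (by
    rw [Fintype.card_fin, Fintype.card_units]; omega)
  have hx : Function.Injective fun c => (x c : K) := Units.val_injective.comp x.injective
  have hx0 : ∀ c, (x c : K) ≠ 0 := fun c => (x c).ne_zero
  exact ⟨_, isMDPCode_of_nontrivialMinorsNeZero hk hkn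
    (nontrivialMinorsNeZero_wrsMatrix hk hkn hx hx0 hγ hdeg)
    (maxMinorDegree_wrsMatrix hk hkn hx hx0 hγ)⟩

/-- A field with `q ^ s` elements is an extension of degree `s` of a field with `q` elements, and
simple. -/
lemma exists_subfield_and_generator {q s : ℕ} (hq : IsPrimePow q) (hs : 0 < s) (F : Type*)
    [Field F] [Fintype F] (hF : Fintype.card F = q ^ s) :
    ∃ (K : Type) (_ : Field K) (_ : Fintype K) (_ : Algebra K F) (γ : F),
      Fintype.card K = q ∧ γ ≠ 0 ∧ (minpoly K γ).natDegree = s := by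
  obtain ⟨p, e, hp, he, rfl⟩ := hq
  have hp := hp.nat_prime
  have : Fact p.Prime := ⟨hp⟩
  have : CharP F p := by
    obtain ⟨p', hp'⟩ := CharP.exists F
    obtain ⟨m, hp'', hm⟩ := FiniteField.card F p'
    have h1 : p ∣ p' ^ (m : ℕ) := by
      rw [← hm, hF]
      exact dvd_pow (dvd_pow_self p he.ne') hs.ne'
    rwa [(Nat.prime_dvd_prime_iff_eq hp hp'').1 (hp.dvd_of_dvd_pow h1)]
  let : Algebra (ZMod p) F := ZMod.algebra F p
  have hfin : Module.finrank (ZMod p) F = e * s := by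
    have h1 := Module.card_eq_pow_finrank (K := ZMod p) (V := F)
    rw [hF, ZMod.card, ← pow_mul] at h1
    exact (Nat.pow_right_injective hp.two_le h1).symm
  obtain ⟨f⟩ : Nonempty (GaloisField p e →ₐ[ZMod p] F) :=
    FiniteField.nonempty_algHom_of_finrank_dvd (by
      rw [hfin, GaloisField.finrank p he.ne']
      exact dvd_mul_right e s)
  let : Fintype (GaloisField p e) := Fintype.ofFinite _
  let : Algebra (GaloisField p e) F := f.toRingHom.toAlgebra
  have hcard : Fintype.card (GaloisField p e) = p ^ e := by
    rw [← Nat.card_eq_fintype_card, GaloisField.card p e he.ne']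
  have hfin' : Module.finrank (GaloisField p e) F = s := by
    have h1 := Module.card_eq_pow_finrank (K := GaloisField p e) (V := F)
    rw [hF, hcard] at h1
    exact (Nat.pow_right_injective (hp.two_le.trans (Nat.le_self_pow he.ne' p)) h1).symm
  obtain ⟨γ, hγ⟩ := Field.exists_primitive_element (GaloisField p e) F
  have hdeg := (Field.primitive_element_iff_minpoly_natDegree_eq (GaloisField p e) γ).1 hγ
  rw [hfin'] at hdeg
  -- Zero can be a primitive element only if `s = 1`, and then `1` serves as well.
  by_cases h0 : γ = 0
  · have h1 : s = 1 := by
      rw [← hdeg, h0, minpoly.zero, natDegree_X]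
    exact ⟨_, inferInstance, inferInstance, inferInstance, 1, hcard, one_ne_zero, by
      rw [minpoly.one, ← C_1, natDegree_X_sub_C, h1]⟩
  · exact ⟨_, inferInstance, inferInstance, inferInstance, γ, hcard, h0, hdeg⟩

theorem exists_isMDPCode {n k δ q s : ℕ} (hk : 0 < k) (hkn : k < n) (hq : IsPrimePow q)
    (hqn : n < q) (F : Type*) [Field F] [Fintype F] (hF : Fintype.card F = q ^ s) (hs : 0 < s)
    (hdeg : ((δ / k + δ / (n - k) : ℕ) : ℤ) * ∑ r ∈ Finset.range k, rowSpread k δ r < 4 * s) :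
    ∃ C : Submodule F[X] (Fin n → F[X]), IsMDPCode n k δ C := by
  obtain ⟨K, _, _, _, γ, hK, hγ, hγs⟩ := exists_subfield_and_generator hq hs F hF
  exact exists_isMDPCode_of_lt hk hkn (hqn.trans_eq hK.symm) hγ (hγs ▸ hdeg)

/-- The number of block columns involved in the MDP property. -/
lemma cast_div_add_div_le {n k : ℕ} (hk : 0 < k) (hkn : k < n) (δ : ℕ) :
    ((δ / k + δ / (n - k) : ℕ) : ℝ) ≤ δ / k + δ / (min k (n - k) : ℕ) := by
  have ht : 0 < min k (n - k) := lt_min hk (Nat.sub_pos_of_lt hkn)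
  rw [Nat.cast_add]
  refine add_le_add Nat.cast_div_le (Nat.cast_div_le.trans ?_)
  exact div_le_div_of_nonneg_left (Nat.cast_nonneg _) (Nat.cast_pos.2 ht)
    (Nat.cast_le.2 (min_le_right _ _))

end Existence

end ConvCode

theorem mainTheorem4 (n k δ q s t : ℕ) (hk : 0 < k) (hkn : k < n) (hδ : 0 < δ)
    (ht : t = min k (n - k)) (hq : IsPrimePow q) (hqn : n < q)
    (F : Type*) [Field F] [Fintype F] (hF : Fintype.card F = q ^ s) :
    ((δ : ℝ) ^ 3 / (3 * (t : ℝ)) + 3 * (δ : ℝ) ^ 2 / 4 + (δ : ℝ) * (t : ℝ) / 12 < (s : ℝ) →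
      ∃ C : Submodule (Polynomial F) (Fin n → Polynomial F), ConvCode.IsMDPCode n k δ C) ∧
    (11 / 24 * ((δ : ℝ) ^ 3 / (t : ℝ) + (δ : ℝ) * (t : ℝ)) < (s : ℝ) →
      ∃ C : Submodule (Polynomial F) (Fin n → Polynomial F), ConvCode.IsMDPCode n k δ C) := by
  have ht0 : (0 : ℝ) < t := by
    rw [Nat.cast_pos, ht]
    exact lt_min hk (Nat.sub_pos_of_lt hkn)
  have htk : (t : ℝ) ≤ k := Nat.cast_le.2 (ht ▸ min_le_left _ _)
  have hδ0 : (0 : ℝ) < δ := Nat.cast_pos.2 hδ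
  have hl := ConvCode.cast_div_add_div_le hk hkn δ
  rw [← ht] at hl
  have hS : (0 : ℝ) ≤ ((∑ r ∈ Finset.range k, ConvCode.rowSpread k δ r : ℤ) : ℝ) :=
    Int.cast_nonneg (Finset.sum_nonneg fun r _ => ConvCode.rowSpread_nonneg k δ r)
  have hS1 : ((∑ r ∈ Finset.range k, ConvCode.rowSpread k δ r : ℤ) : ℝ) ≤ (δ : ℝ) ^ 2 := by
    exact_mod_cast ConvCode.sum_rowSpread_le_sq hk δ
  have hS2 : 2 * ((∑ r ∈ Finset.range k, ConvCode.rowSpread k δ r : ℤ) : ℝ) ≤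
      (δ : ℝ) ^ 2 + 2 * (δ * k) := by
    have h1 : (2 * (∑ r ∈ Finset.range k, ConvCode.rowSpread k δ r : ℤ) : ℝ) ≤
        (δ : ℝ) ^ 2 + 2 * (δ * (k - 1)) := by
      exact_mod_cast ConvCode.two_mul_sum_rowSpread_le hk δ
    nlinarith
  have hex : ∀ B : ℝ, 0 < B → ((δ / k + δ / (n - k) : ℕ) : ℝ) *
      ((∑ r ∈ Finset.range k, ConvCode.rowSpread k δ r : ℤ) : ℝ) ≤ 4 * B → B < s →
      ∃ C : Submodule (Polynomial F) (Fin n → Polynomial F), ConvCode.IsMDPCode n k δ C := by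
    intro B hB h1 h2
    refine ConvCode.exists_isMDPCode hk hkn hq hqn F hF (Nat.cast_pos.1 (hB.trans h2)) ?_
    have h3 := h1.trans_lt (mul_lt_mul_of_pos_left h2 four_pos)
    rw [← Int.cast_lt (R := ℝ), Int.cast_mul, Int.cast_natCast, Int.cast_mul, Int.cast_natCast,
      Int.cast_ofNat]
    exact h3
  exact ⟨hex _ (by positivity) (ConvCode.mul_le_first_bound hδ0.le ht0 htk hl hS hS1 hS2),
    hex _ (by positivity) (ConvCode.mul_le_second_bound hδ0.le ht0 htk hl hS hS1 hS2)⟩
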